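/- All meet-semilattices have a top element. A meet-semilattice $M$ is distributive if $a\wedge b\le c$ implies that there are $a'\ge a$, $b'\ge b$ with $a'\wedge b'=c$. An element $k$ of a complete lattice $L$ is compact if $k\le\bigvee S$ implies $k\le\bigvee T$ for some finite $T\subseteq S$; a frame is algebraic if each of its elements is a join of compact elements, and an algebraic frame is arithmetic if $a\wedge b$ is compact whenever $a,b$ are compact. Arithmetic frames. $\mathsf{ArFrm}_{\mathsf J}$ is the category of arithmetic frames and maps preserving arbitrary joins and compact elements. $\mathsf{ArFrm}_{\mathsf S}$ is its wide subcategory of those $\alpha$ such that $\alpha(\bigwedge S)=\bigwedge\alpha[S]$ for each nonempty finite set $S$ of compact elements whose meet is compact. $\mathsf{ArFrm}$ is the wide subcategory of those $\alpha$ that preserve all finite meets, including the top. Lattices. $\mathsf{DL}^-_{\mathsf M}$ is the category of distributive meet-semilattices that are lattices (that is, distributive lattices with top but possibly without bottom) and maps preserving all finite meets, including the top. $\mathsf{DL}^-$ is its wide subcategory of maps that preserve existing joins of nonempty finite sets (that is, of lattice homomorphisms preserving the top). $\mathsf{DL}^-_{\mathsf P}$ is the wide subcategory of those $\alpha:M_1\to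 M_2$ such that, for each finite (possibly empty) $S\subseteq M_1$ and each upper bound $x$ of $\alpha[S]$, there is an upper bound $c$ of $S$ with $\alpha(c)\le x$. Spaces. A Priestley space is a compact ordered space in which $x\not\le y$ implies that some clopen upset contains $x$ and misses $y$. Given a subset $X_0$ of a Priestley space $X$, a clopen upset $U$ is admissible if $\max(X\setminus U)\subseteq X_0$; let $\mathcal A(X)$ be the set of admissible clopen upsets and $\mathcal I_x=\{U\in\mathcal A(X): x\notin U\}$. A pointed generalized Priestley space is a tuple $(X,\tau,\le,X_0,m)$ where $(X,\tau,\le)$ is a Priestley space, $m$ is the greatest element of $X$, $X_0$ is a dense subset of $X\setminus\{m\}$, each $x\ne m$ lies below some element of $X_0$, $x\in X_0$ iff $\mathcal I_x$ is nonempty and directed, and $x\le y$ iff every $U\in\mathcal A(X)$ containing $x$ contains $y$. It is a pointed Priestley space if $X_0=X\setminus\{m\}$. For a relation $R\subseteq X\times Y$ put $\Box_RU=\{x\in X: R[x]\subseteq U\}$. A generalized Priestley morphism is a relation $R\subseteq X\times Y$ such that $\Box_RU\in\mathcal A(X)$ for all $U\in\mathcal A(Y)$, and, whenever $(x,y)\notin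 R$, there is $U\in\mathcal A(Y)$ with $R[x]\subseteq U$ and $y\notin U$. $\mathsf{PPS}$ is the category of pointed Priestley spaces and generalized Priestley morphisms; the identities are the orders $\le$, and the composite of $R\subseteq X\times Y$ and $T\subseteq Y\times Z$ is given by $x\,(T*R)\,z$ iff every $U\in\mathcal A(Z)$ with $x\in\Box_R\Box_TU$ contains $z$. $\mathsf{PPS}_{\mathsf S}$ is the category of pointed Priestley spaces and strong Priestley morphisms, i.e. order-preserving maps $f:X\to Y$ with $f^{-1}(U)\in\mathcal A(X)$ for all $U\in\mathcal A(Y)$. $\mathsf{PPS}_{\mathsf P}$ is its wide subcategory of the maps with $f[X_0]\subseteq Y_0$. Theorem. 1. $\mathsf{ArFrm}_{\mathsf J}$ is equivalent to $\mathsf{DL}^-_{\mathsf M}$ and dually equivalent to $\mathsf{PPS}$. 2. $\mathsf{ArFrm}_{\mathsf S}$ is equivalent to $\mathsf{DL}^-$ and dually equivalent to $\mathsf{PPS}_{\mathsf S}$. 3. $\mathsf{ArFrm}$ is equivalent to $\mathsf{DL}^-_{\mathsf P}$ and dually equivalent to $\mathsf{PPS}_{\mathsf P}$. -/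

import Mathlib

open CategoryTheory

universe u

namespace PointedPriestley

/-! ### Algebraic frames -/

/-- An algebraic frame: a frame in which every element is a join of compact elements. -/
structure AlgFrmJ : Type (u + 1) where
  carrier : Type u
  [frame : Order.Frame carrier]
  [algebraic : IsCompactlyGenerated carrier]

attribute [instance] AlgFrmJ.frame AlgFrmJ.algebraic

namespace AlgFrmJ

instance : CoeSort AlgFrmJ.{u} (Type u) := ⟨AlgFrmJ.carrier⟩

/-- Maps preserving arbitrary joins and compact elements (finite meets need not be preserved). -/
@[ext]
structure Hom (L M : AlgFrmJ.{u}) where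
  map : sSupHom L M
  map_compact : ∀ k : L, IsCompactElement k → IsCompactElement (map k)

instance : Category AlgFrmJ.{u} where
  Hom L M := Hom L M
  id L := ⟨sSupHom.id L, fun _ hk => hk⟩
  comp f g := ⟨g.map.comp f.map, fun k hk => g.map_compact _ (f.map_compact k hk)⟩

/-- Meets of nonempty finite sets of compact elements are preserved whenever they are compact. -/
def PreservesCompactMeets : MorphismProperty AlgFrmJ.{u} := fun L _ f =>
  ∀ S : Set L, S.Finite → S.Nonempty → (∀ s ∈ S, IsCompactElement s) → IsCompactElement (sInf S) →
    f.map (sInf S) = sInf (f.map '' S)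

instance : PreservesCompactMeets.{u}.IsMultiplicative where
  id_mem L := by
    intro S _ _ _ _
    change sInf S = sInf ((fun x => x) '' S)
    rw [Set.image_id']
  comp_mem f g hf hg := by
    intro S hS hne hc hk
    change g.map (f.map (sInf S)) = sInf ((fun x => g.map (f.map x)) '' S)
    have h := hf S hS hne hc hk
    rw [h, hg (f.map '' S) (hS.image _) (hne.image _)
      (by rintro _ ⟨s, hs, rfl⟩; exact f.map_compact s (hc s hs))
      (h ▸ f.map_compact _ hk), Set.image_image]

/-- All finite meets, the empty one included, are preserved. -/
def PreservesFiniteMeets : MorphismProperty AlgFrmJ.{u} := fun L _ f =>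
  ∀ S : Set L, S.Finite → f.map (sInf S) = sInf (f.map '' S)

instance : PreservesFiniteMeets.{u}.IsMultiplicative where
  id_mem L := by
    intro S _
    change sInf S = sInf ((fun x => x) '' S)
    rw [Set.image_id']
  comp_mem f g hf hg := by
    intro S hS
    change g.map (f.map (sInf S)) = sInf ((fun x => g.map (f.map x)) '' S)
    rw [hf S hS, hg (f.map '' S) (hS.image _), Set.image_image]

/-- An algebraic frame is arithmetic if binary meets of compact elements are compact. -/
def IsArithmetic : ObjectProperty AlgFrmJ.{u} := fun L =>
  ∀ a b : L, IsCompactElement a → IsCompactElement b → IsCompactElement (a ⊓ b)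

end AlgFrmJ

/-- Algebraic frames with the morphisms that preserve compact meets of nonempty finite sets of
compact elements. -/
abbrev AlgFrmS := WideSubcategory AlgFrmJ.PreservesCompactMeets.{u}

/-- Algebraic frames with the frame homomorphisms that preserve compact elements. -/
abbrev AlgFrm := WideSubcategory AlgFrmJ.PreservesFiniteMeets.{u}

abbrev ArFrmJ := AlgFrmJ.IsArithmetic.{u}.FullSubcategory

abbrev ArFrmS :=
  ObjectProperty.FullSubcategory (C := AlgFrmS.{u}) fun L => AlgFrmJ.IsArithmetic L.obj

abbrev ArFrm :=
  ObjectProperty.FullSubcategory (C := AlgFrm.{u}) fun L => AlgFrmJ.IsArithmetic L.obj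

/-! ### Distributive meet-semilattices -/

/-- Distributivity of a meet-semilattice. -/
def IsDistributive : ObjectProperty SemilatInfCat.{u} := fun M =>
  ∀ a b c : M, a ⊓ b ≤ c → ∃ a' b' : M, a ≤ a' ∧ b ≤ b' ∧ a' ⊓ b' = c

/-- Distributive meet-semilattices (with top) and maps preserving all finite meets (hence top). -/
abbrev DMS := IsDistributive.{u}.FullSubcategory

namespace DMS

/-- The underlying map of a morphism. -/
def map {M N : DMS.{u}} (f : M ⟶ N) : InfTopHom M.obj N.obj := f.hom

/-- Joins of nonempty finite sets are preserved whenever they exist. -/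
def PreservesJoins : MorphismProperty DMS.{u} := fun M _ f =>
  ∀ (S : Set M.obj) (a : M.obj), S.Finite → S.Nonempty → IsLUB S a → IsLUB (map f '' S) (map f a)

instance : PreservesJoins.{u}.IsMultiplicative where
  id_mem M := by
    intro S a _ _ h
    change IsLUB ((fun x => x) '' S) a
    rwa [Set.image_id']
  comp_mem f g hf hg := by
    intro S a hS hne h
    change IsLUB ((fun x => map g (map f x)) '' S) (map g (map f a))
    rw [← Set.image_image (map g) (map f)]
    exact hg _ _ (hS.image _) (hne.image _) (hf S a hS hne h)

/-- Every upper bound of the image of a finite set `S` (possibly empty) lies above the image of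
an upper bound of `S`. -/
def LiftsUpperBounds : MorphismProperty DMS.{u} := fun M N f =>
  ∀ (S : Set M.obj) (x : N.obj), S.Finite → x ∈ upperBounds (map f '' S) →
    ∃ c ∈ upperBounds S, map f c ≤ x

instance : LiftsUpperBounds.{u}.IsMultiplicative where
  id_mem M := by
    intro S x _ h
    change x ∈ upperBounds ((fun x => x) '' S) at h
    rw [Set.image_id'] at h
    exact ⟨x, h, le_rfl⟩
  comp_mem f g hf hg := by
    intro S x hS h
    change x ∈ upperBounds ((fun x => map g (map f x)) '' S) at h
    rw [← Set.image_image (map g) (map f)] at h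
    obtain ⟨c, hc, hcx⟩ := hg _ x (hS.image _) h
    obtain ⟨d, hd, hdc⟩ := hf S c hS hc
    exact ⟨d, hd, le_trans (OrderHomClass.mono (map g) hdc) hcx⟩

/-- A meet-semilattice is a lattice if all binary joins exist (a bottom is not required). -/
def IsLattice : ObjectProperty DMS.{u} := fun M =>
  ∀ a b : M.obj, ∃ c : M.obj, IsLUB {a, b} c

end DMS

abbrev DMSS := WideSubcategory DMS.PreservesJoins.{u}

abbrev DMSP := WideSubcategory DMS.LiftsUpperBounds.{u}

/-- Distributive lattices with top and maps preserving all finite meets. -/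
abbrev DLM := DMS.IsLattice.{u}.FullSubcategory

/-- Distributive lattices with top and lattice homomorphisms preserving top. -/
abbrev DL :=
  ObjectProperty.FullSubcategory (C := DMSS.{u}) fun M => DMS.IsLattice M.obj

/-- Distributive lattices with top, morphisms lifting upper bounds of finite sets. -/
abbrev DLP :=
  ObjectProperty.FullSubcategory (C := DMSP.{u}) fun M => DMS.IsLattice M.obj

/-! ### Pointed generalized Priestley spaces -/

/-- Admissible clopen upsets with respect to `X₀`: the maximal points of the complement
belong to `X₀`. -/
def IsAdmissible {α : Type u} [PartialOrder α] [TopologicalSpace α] (X₀ U : Set α) : Prop :=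
  IsClopen U ∧ IsUpperSet U ∧ ∀ x, Maximal (fun y => y ∉ U) x → x ∈ X₀

theorem IsAdmissible.univ {α : Type u} [PartialOrder α] [TopologicalSpace α] (X₀ : Set α) :
    IsAdmissible X₀ Set.univ :=
  ⟨isClopen_univ, isUpperSet_univ, fun _ hx => absurd (Set.mem_univ _) hx.prop⟩

theorem IsAdmissible.inter {α : Type u} [PartialOrder α] [TopologicalSpace α] {X₀ U V : Set α}
    (hU : IsAdmissible X₀ U) (hV : IsAdmissible X₀ V) : IsAdmissible X₀ (U ∩ V) := by
  refine ⟨hU.1.inter hV.1, hU.2.1.inter hV.2.1, fun x hx => ?_⟩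
  by_cases h : x ∈ U
  · exact hV.2.2 x ⟨fun h' => hx.prop ⟨h, h'⟩, fun y hy hxy => hx.le_of_ge (fun h' => hy h'.2) hxy⟩
  · exact hU.2.2 x ⟨h, fun y hy hxy => hx.le_of_ge (fun h' => hy h'.1) hxy⟩

/-- A pointed generalized Priestley space `(X, τ, ≤, X₀, m)`. -/
structure PGPS : Type (u + 1) where
  carrier : Type u
  [partialOrder : PartialOrder carrier]
  [topology : TopologicalSpace carrier]
  [compact : CompactSpace carrier]
  [priestley : PriestleySpace carrier]
  X₀ : Set carrier
  m : carrier
  isTop_m : IsTop m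
  subset_compl : X₀ ⊆ {m}ᶜ
  dense : {m}ᶜ ⊆ closure X₀
  order_dense : ∀ x, x ≠ m → ∃ y ∈ X₀, x ≤ y
  mem_X₀_iff : ∀ x, x ∈ X₀ ↔
    {U | IsAdmissible X₀ U ∧ x ∉ U}.Nonempty ∧
      DirectedOn (· ⊆ ·) {U | IsAdmissible X₀ U ∧ x ∉ U}
  le_iff : ∀ x y, x ≤ y ↔ ∀ U, IsAdmissible X₀ U → x ∈ U → y ∈ U

attribute [instance] PGPS.partialOrder PGPS.topology PGPS.compact PGPS.priestley

namespace PGPS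

instance : CoeSort PGPS.{u} (Type u) := ⟨PGPS.carrier⟩

/-- The admissible clopen upsets of `X`. -/
def admissible (X : PGPS.{u}) : Set (Set X) := {U | IsAdmissible X.X₀ U}

/-- `box R U` is the set of all `x` with `R[x] ⊆ U`. -/
def box {α β : Type u} (R : α → β → Prop) (U : Set β) : Set α := {x | ∀ y, R x y → y ∈ U}

/-- A generalized Priestley morphism. -/
@[ext]
structure Hom (X Y : PGPS.{u}) where
  rel : X → Y → Prop
  separated : ∀ x y, ¬ rel x y → ∃ U ∈ Y.admissible, (∀ z, rel x z → z ∈ U) ∧ y ∉ U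
  box_mem : ∀ U ∈ Y.admissible, box rel U ∈ X.admissible

/-- The composition `S * R`. -/
def compRel {X Y Z : PGPS.{u}} (R : Hom X Y) (S : Hom Y Z) (x : X) (z : Z) : Prop :=
  ∀ U ∈ Z.admissible, x ∈ box R.rel (box S.rel U) → z ∈ U

theorem box_box_inter {X Y Z : PGPS.{u}} (R : Hom X Y) (S : Hom Y Z) {U V : Set Z} {x : X}
    (hU : x ∈ box R.rel (box S.rel U)) (hV : x ∈ box R.rel (box S.rel V)) :
    x ∈ box R.rel (box S.rel (U ∩ V)) :=
  fun y hy z hz => ⟨hU y hy z hz, hV y hy z hz⟩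

theorem box_compRel {X Y Z : PGPS.{u}} (R : Hom X Y) (S : Hom Y Z) {U : Set Z}
    (hU : U ∈ Z.admissible) : box (compRel R S) U = box R.rel (box S.rel U) := by
  ext x
  constructor
  · intro hx
    let ι := {V : Set Z // V ∈ Z.admissible ∧ x ∈ box R.rel (box S.rel V)}
    have : Nonempty ι := ⟨⟨Set.univ, IsAdmissible.univ _, fun _ _ _ _ => Set.mem_univ _⟩⟩
    obtain ⟨V, hV⟩ := exists_subset_nhds_of_isCompact' (ι := ι) (V := fun V : ι => V.1)
      (fun V W : ι => ⟨⟨V.1 ∩ W.1, V.2.1.inter W.2.1, box_box_inter R S V.2.2 W.2.2⟩,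
        Set.inter_subset_left, Set.inter_subset_right⟩)
      (fun V : ι => V.2.1.1.1.isCompact) (fun V : ι => V.2.1.1.1) (U := U) (by
        intro z hz
        exact hU.1.2.mem_nhds (hx z fun V hV hxV => Set.mem_iInter.1 hz ⟨V, hV, hxV⟩))
    exact fun y hy z hz => hV (V.2.2 y hy z hz)
  · exact fun hx z hz => hz U hU hx

/-- A generalized Priestley morphism is determined by its action on admissible clopen upsets. -/
theorem rel_iff {X Y : PGPS.{u}} (R : Hom X Y) (x : X) (y : Y) :
    R.rel x y ↔ ∀ U ∈ Y.admissible, x ∈ box R.rel U → y ∈ U := by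
  constructor
  · exact fun h U _ hx => hx y h
  · intro h
    by_contra hn
    obtain ⟨U, hU, hx, hy⟩ := R.separated x y hn
    exact hy (h U hU hx)

theorem Hom.ext_box {X Y : PGPS.{u}} {R S : Hom X Y}
    (h : ∀ U ∈ Y.admissible, box R.rel U = box S.rel U) : R = S := by
  ext x y
  rw [rel_iff R, rel_iff S]
  exact forall₂_congr fun U hU => by rw [h U hU]

/-- The identity morphism is the order relation. -/
def Hom.id (X : PGPS.{u}) : Hom X X where
  rel x y := x ≤ y
  separated x y h := by
    rw [X.le_iff] at h
    push Not at h
    obtain ⟨U, hU, hx, hy⟩ := h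
    exact ⟨U, hU, fun z hz => hU.2.1 hz hx, hy⟩
  box_mem U hU := by
    have : box (fun x y : X => x ≤ y) U = U :=
      Set.ext fun x => ⟨fun h => h x le_rfl, fun h y hy => hU.2.1 hy h⟩
    rwa [this]

theorem box_id (X : PGPS.{u}) {U : Set X} (hU : U ∈ X.admissible) :
    box (Hom.id X).rel U = U :=
  Set.ext fun x => ⟨fun h => h x le_rfl, fun h _ hy => hU.2.1 hy h⟩

def Hom.comp {X Y Z : PGPS.{u}} (R : Hom X Y) (S : Hom Y Z) : Hom X Z where
  rel := compRel R S
  separated x z h := by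
    simp only [compRel] at h
    push Not at h
    obtain ⟨U, hU, hx, hz⟩ := h
    exact ⟨U, hU, fun w hw => hw U hU hx, hz⟩
  box_mem U hU := by
    rw [box_compRel R S hU]
    exact R.box_mem _ (S.box_mem U hU)

theorem Hom.box_comp {X Y Z : PGPS.{u}} (R : Hom X Y) (S : Hom Y Z) {U : Set Z}
    (hU : U ∈ Z.admissible) : box (R.comp S).rel U = box R.rel (box S.rel U) :=
  box_compRel R S hU

instance : Category PGPS.{u} where
  Hom X Y := Hom X Y
  id X := Hom.id X
  comp R S := R.comp S
  id_comp R := Hom.ext_box fun U hU => by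
    rw [Hom.box_comp _ _ hU, box_id _ (R.box_mem U hU)]
  comp_id R := Hom.ext_box fun U hU => by
    rw [Hom.box_comp _ _ hU, box_id _ hU]
  assoc R S T := Hom.ext_box fun U hU => by
    rw [Hom.box_comp _ _ hU, Hom.box_comp _ _ (T.box_mem U hU), Hom.box_comp _ _ hU,
      Hom.box_comp _ _ hU]

/-- A pointed Priestley space is a pointed generalized Priestley space with `X₀ = X ∖ {m}`. -/
def IsPointedPriestley : ObjectProperty PGPS.{u} := fun X => X.X₀ = {X.m}ᶜ

end PGPS

/-- The category whose objects are pointed generalized Priestley spaces and whose morphisms are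
strong Priestley morphisms. -/
structure PGPSS : Type (u + 1) where
  space : PGPS.{u}

namespace PGPSS

/-- A strong Priestley morphism: an order-preserving map that pulls admissible clopen upsets
back to admissible clopen upsets. -/
@[ext]
structure Hom (X Y : PGPSS.{u}) where
  map : X.space → Y.space
  monotone : Monotone map
  preimage_mem : ∀ U ∈ Y.space.admissible, map ⁻¹' U ∈ X.space.admissible

instance : Category PGPSS.{u} where
  Hom X Y := Hom X Y
  id X := ⟨fun x => x, monotone_id, fun _ hU => hU⟩
  comp f g := ⟨fun x => g.map (f.map x), g.monotone.comp f.monotone,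
    fun U hU => f.preimage_mem _ (g.preimage_mem U hU)⟩

/-- The maps with `f[X₀] ⊆ Y₀`. -/
def PreservesDensePart : MorphismProperty PGPSS.{u} := fun X Y f =>
  ∀ x ∈ X.space.X₀, f.map x ∈ Y.space.X₀

instance : PreservesDensePart.{u}.IsMultiplicative where
  id_mem _ := fun _ hx => hx
  comp_mem _ _ hf hg := fun x hx => hg _ (hf x hx)

end PGPSS

abbrev PGPSP := WideSubcategory PGPSS.PreservesDensePart.{u}

abbrev PPS := PGPS.IsPointedPriestley.{u}.FullSubcategory

abbrev PPSS :=
  ObjectProperty.FullSubcategory (C := PGPSS.{u}) fun X => PGPS.IsPointedPriestley X.space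

abbrev PPSP :=
  ObjectProperty.FullSubcategory (C := PGPSP.{u}) fun X => PGPS.IsPointedPriestley X.obj.space

end PointedPriestley

namespace PointedPriestley

/-! ### Maps of distributive lattices with top -/

section Order

variable {α β : Type*}

/-! Lattices mediate: frames are compared with them covariantly, spaces contravariantly, and
composing gives the dual equivalences between frames and spaces.

An arithmetic frame is the ideal completion of its lattice of compact elements. A map preserving
joins and compactness is therefore the same as a map of compact elements preserving finite joins
(`exists_sSupHom_extension`). Reversing the order turns finite joins, the bottom included, into
finite meets with top. Preserving meets of compact elements then becomes preserving binary joins,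
and preserving the top of the frame becomes coinitiality of the image. By `DMS.liftsUpperBounds_iff`
these two conditions together say that upper bounds lift.

In a pointed Priestley space the admissible sets are the clopen upsets containing `m`, and they form
a distributive lattice. Compactness shows that each meet-preserving map between such lattices is
`box` of a relation, and that each prime filter, possibly improper, comes from a point
(`PGPS.exists_mem_iff_of_prime`); hence join-preserving maps are preimages under functions. Such a
function sends only `m` to `m` exactly when the preimage map has coinitial image. A lattice need not
have a bottom, so its dual space includes the improper prime filter, which becomes `m`. -/

theorem isLUB_insert_of_isLUB_pair [Preorder α] {S : Set α} {a b c : α} (hS : IsLUB S b)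
    (hc : IsLUB {a, b} c) : IsLUB (insert a S) c := by
  rw [isLUB_iff_le_iff] at *
  intro d
  rw [hc d, upperBounds_insert, upperBounds_insert, upperBounds_singleton]
  simp only [Set.mem_inter_iff, Set.mem_Ici, hS d]

/-- A map that preserves binary joins, all of which exist, preserves joins of nonempty finite
sets. -/
theorem isLUB_image_of_pair [PartialOrder α] [PartialOrder β] {f : α → β}
    (hα : ∀ a b : α, ∃ c, IsLUB {a, b} c)
    (hf : ∀ a b c, IsLUB {a, b} c → IsLUB {f a, f b} (f c))
    {S : Set α} {a : α} (hS : S.Finite) (hne : S.Nonempty) (ha : IsLUB S a) :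
    IsLUB (f '' S) (f a) := by
  suffices ∃ b, IsLUB S b ∧ IsLUB (f '' S) (f b) by
    obtain ⟨b, hb, hfb⟩ := this
    rwa [ha.unique hb]
  clear ha
  induction S, hS using Set.Finite.induction_on with
  | empty => exact absurd hne Set.not_nonempty_empty
  | @insert x S _ _ ih =>
    rcases S.eq_empty_or_nonempty with rfl | hS'
    · exact ⟨x, by simp⟩
    · obtain ⟨b, hb, hfb⟩ := ih hS'
      obtain ⟨c, hc⟩ := hα x b
      rw [Set.image_insert_eq]
      exact ⟨c, isLUB_insert_of_isLUB_pair hb hc, isLUB_insert_of_isLUB_pair hfb (hf _ _ _ hc)⟩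

end Order

namespace DMS

theorem preservesJoins_iff {M N : DMS.{u}} (hM : IsLattice M) (f : M ⟶ N) :
    PreservesJoins f ↔
      ∀ a b c : M.obj, IsLUB {a, b} c → IsLUB {map f a, map f b} (map f c) := by
  constructor
  · intro h a b c hc
    rw [← Set.image_pair]
    exact h _ _ (Set.toFinite _) (Set.insert_nonempty _ _) hc
  · intro h S a hS hne ha
    exact isLUB_image_of_pair hM h hS hne ha

/-- For nonempty finite `S` the join of `S` is the best candidate for `c`, so lifting amounts to
preserving that join. For `S = ∅` every element is an upper bound, and lifting says that the image
is coinitial. -/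
theorem liftsUpperBounds_iff {M N : DMS.{u}} (hM : IsLattice M) (f : M ⟶ N) :
    LiftsUpperBounds f ↔ PreservesJoins f ∧ ∀ y : N.obj, ∃ x : M.obj, map f x ≤ y := by
  constructor
  · intro h
    refine ⟨fun S a hS _ ha => ⟨(OrderHomClass.mono (map f)).mem_upperBounds_image ha.1,
      fun x hx => ?_⟩, fun y => ?_⟩
    · obtain ⟨c, hc, hcx⟩ := h S x hS hx
      exact (OrderHomClass.mono (map f) (ha.2 hc)).trans hcx
    · obtain ⟨c, -, hc⟩ := h ∅ y Set.finite_empty (by simp)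
      exact ⟨c, hc⟩
  · rintro ⟨hj, hl⟩ S x hS hx
    rcases S.eq_empty_or_nonempty with rfl | hne
    · obtain ⟨c, hc⟩ := hl x
      exact ⟨c, by simp, hc⟩
    · obtain ⟨a, ha⟩ : ∃ a, IsLUB S a := by
        clear hx
        induction S, hS using Set.Finite.induction_on with
        | empty => exact absurd hne Set.not_nonempty_empty
        | @insert x S _ _ ih =>
          rcases S.eq_empty_or_nonempty with rfl | hS'
          · exact ⟨x, by simp⟩
          · obtain ⟨b, hb⟩ := ih hS'
            obtain ⟨c, hc⟩ := hM x b
            exact ⟨c, isLUB_insert_of_isLUB_pair hb hc⟩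
      exact ⟨a, ha.1, (hj S a hS hne ha).2 hx⟩

theorem hom_ext {M N : DMS.{u}} {f g : M ⟶ N} (h : ∀ a, map f a = map g a) : f = g :=
  ObjectProperty.hom_ext _ (InfTopHom.ext h)

/-- The morphism underlying an order isomorphism. -/
def homOfOrderIso {M N : DMS.{u}} (e : M.obj ≃o N.obj) : M ⟶ N :=
  ObjectProperty.homMk (⟨⟨e, map_inf e⟩, map_top e⟩ : InfTopHom M.obj N.obj)

theorem homOfOrderIso_comp_symm {M N : DMS.{u}} (e : M.obj ≃o N.obj) :
    homOfOrderIso e ≫ homOfOrderIso e.symm = 𝟙 M :=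
  hom_ext e.symm_apply_apply

theorem homOfOrderIso_symm_comp {M N : DMS.{u}} (e : M.obj ≃o N.obj) :
    homOfOrderIso e.symm ≫ homOfOrderIso e = 𝟙 N :=
  hom_ext e.apply_symm_apply

theorem preservesJoins_homOfOrderIso {M N : DMS.{u}} (e : M.obj ≃o N.obj) :
    PreservesJoins (homOfOrderIso e) :=
  fun _ _ _ _ h => e.isLUB_image'.2 h

theorem liftsUpperBounds_homOfOrderIso {M N : DMS.{u}} (e : M.obj ≃o N.obj) :
    LiftsUpperBounds (homOfOrderIso e) := by
  intro S x _ hx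
  refine ⟨e.symm x, fun s hs => ?_, (e.apply_symm_apply x).le⟩
  exact e.le_symm_apply.2 (hx ⟨s, hs, rfl⟩)

/-- An order isomorphism is an isomorphism of distributive meet-semilattices. -/
def isoOfOrderIso {M N : DMS.{u}} (e : M.obj ≃o N.obj) : M ≅ N where
  hom := homOfOrderIso e
  inv := homOfOrderIso e.symm
  hom_inv_id := homOfOrderIso_comp_symm e
  inv_hom_id := homOfOrderIso_symm_comp e

/-- The distributive lattice structure of a distributive meet-semilattice that is a lattice. -/
noncomputable abbrev distribLattice (M : DMS.{u}) (hM : IsLattice M) : DistribLattice M.obj :=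
  letI : Lattice M.obj :=
    { M.obj.isSemilatticeInf with
      sup := fun a b => (hM a b).choose
      le_sup_left := fun a b => (hM a b).choose_spec.1 (by simp)
      le_sup_right := fun a b => (hM a b).choose_spec.1 (by simp)
      sup_le := fun a b c ha hb => (hM a b).choose_spec.2 (by
        rintro x (rfl | rfl)
        exacts [ha, hb]) }
  { (inferInstance : Lattice M.obj) with
    le_sup_inf := fun x y z => by
      -- Distributivity splits `x ⊔ y ⊓ z` as `b ⊓ c` with `y ≤ b` and `z ≤ c`; both factors also
      -- lie above `x`, hence above `x ⊔ y` and `x ⊔ z`.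
      obtain ⟨b, c, hb, hc, h⟩ := M.property y z (x ⊔ y ⊓ z) le_sup_right
      rw [← h]
      exact inf_le_inf (sup_le (le_sup_left.trans (h.symm.le.trans inf_le_left)) hb)
        (sup_le (le_sup_left.trans (h.symm.le.trans inf_le_right)) hc) }

end DMS

/-- A distributive lattice with top, as a distributive meet-semilattice. -/
def dmsOf (α : Type u) [DistribLattice α] [OrderTop α] : DMS.{u} where
  obj := SemilatInfCat.of α
  property := fun (a b c : α) h =>
    ⟨a ⊔ c, b ⊔ c, le_sup_left, le_sup_left, by
      change (a ⊔ c) ⊓ (b ⊔ c) = c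
      rw [← sup_inf_right, sup_eq_right]
      exact h⟩

theorem isLattice_dmsOf (α : Type u) [DistribLattice α] [OrderTop α] :
    DMS.IsLattice (dmsOf α) :=
  fun (a b : α) => ⟨(a ⊔ b : α), isLUB_pair (γ := α)⟩

/-! ### Arithmetic frames and their compact elements -/

section CompactlyGenerated

variable {α β : Type*} [CompleteLattice α] [CompleteLattice β]

theorem isCompactElement_bot : IsCompactElement (⊥ : α) :=
  fun _ _ ⟨x, hx⟩ _ _ _ => ⟨x, hx, bot_le⟩

theorem isCompactElement_sup {a b : α} (ha : IsCompactElement a) (hb : IsCompactElement b) :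
    IsCompactElement (a ⊔ b) := by
  intro s u hs hd hu hab
  obtain ⟨x, hx, hax⟩ := ha s u hs hd hu (le_sup_left.trans hab)
  obtain ⟨y, hy, hby⟩ := hb s u hs hd hu (le_sup_right.trans hab)
  obtain ⟨z, hz, hxz, hyz⟩ := hd x hx y hy
  exact ⟨z, hz, sup_le (hax.trans hxz) (hby.trans hyz)⟩

theorem directedOn_compact_le (a : α) :
    DirectedOn (· ≤ ·) {c : α | IsCompactElement c ∧ c ≤ a} :=
  fun _ hx _ hy => ⟨_, ⟨isCompactElement_sup hx.1 hy.1, sup_le hx.2 hy.2⟩, le_sup_left, le_sup_right⟩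

/-- The value `f a` is the directed join of the `f k` with `k ≤ a` compact, so a compact element
below it is below one of them. This reduces questions about `f` to compact elements. -/
theorem exists_compact_le_map [IsCompactlyGenerated α] (f : sSupHom α β) {a : α} {c : β}
    (hc : IsCompactElement c) (h : c ≤ f a) :
    ∃ k, IsCompactElement k ∧ k ≤ a ∧ c ≤ f k := by
  rw [← sSup_compact_le_eq a, map_sSup] at h
  obtain ⟨_, ⟨k, hk, rfl⟩, hck⟩ :=
    hc _ _ (Set.Nonempty.image f (s := {c | IsCompactElement c ∧ c ≤ a})
        ⟨⊥, isCompactElement_bot, bot_le⟩)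
      ((directedOn_compact_le a).mono_comp fun _ _ h => OrderHomClass.mono f h) (isLUB_sSup _) h
  exact ⟨k, hk.1, hk.2, hck⟩

theorem sSupHom_ext_compact [IsCompactlyGenerated α] {f g : sSupHom α β}
    (h : ∀ k, IsCompactElement k → f k = g k) : f = g := by
  ext a
  rw [← sSup_compact_le_eq a, map_sSup, map_sSup]
  exact congrArg sSup (Set.image_congr fun k hk => h k hk.1)

/-- A map of compact elements that preserves finite joins extends to all elements. -/
theorem exists_sSupHom_extension [IsCompactlyGenerated α]
    (g : {k : α // IsCompactElement k} → β)
    (hbot : g ⟨⊥, isCompactElement_bot⟩ = ⊥)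
    (hsup : ∀ a b, g ⟨a.1 ⊔ b.1, isCompactElement_sup a.2 b.2⟩ = g a ⊔ g b) :
    ∃ f : sSupHom α β, ∀ k, f k.1 = g k := by
  have hmono : Monotone g := by
    intro a b hab
    have h := hsup a b
    have : (⟨a.1 ⊔ b.1, isCompactElement_sup a.2 b.2⟩ : {k : α // IsCompactElement k}) = b :=
      Subtype.ext (sup_eq_right.2 hab)
    rw [this] at h
    exact h ▸ le_sup_left
  let F : α → β := fun a => ⨆ k : {k : {k : α // IsCompactElement k} // k.1 ≤ a}, g k.1
  -- It suffices to give `F` a right adjoint, since left adjoints preserve joins. The join defining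
  -- the adjoint is directed because `g` preserves finite joins, so a compact element below it is
  -- below some `l` with `g l ≤ b`.
  have hgc : GaloisConnection F fun b => sSup (Subtype.val '' {k : {k : α // IsCompactElement k} | g k ≤ b}) := by
    intro a b
    constructor
    · intro h
      rw [le_iff_compact_le_imp]
      intro k hk hka
      exact le_sSup ⟨⟨k, hk⟩, (le_iSup (fun k : {k : {k : α // IsCompactElement k} // k.1 ≤ a} =>
        g k.1) ⟨⟨k, hk⟩, hka⟩).trans h, rfl⟩
    · intro h
      refine iSup_le fun k => ?_
      obtain ⟨_, ⟨l, hl, rfl⟩, hkl⟩ :=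
        k.1.2 (Subtype.val '' {k : {k : α // IsCompactElement k} | g k ≤ b}) _
          ⟨_, ⟨⟨⊥, isCompactElement_bot⟩, hbot.le.trans bot_le, rfl⟩⟩
          (by
            rintro _ ⟨x, hx, rfl⟩ _ ⟨y, hy, rfl⟩
            exact ⟨_, ⟨⟨x.1 ⊔ y.1, isCompactElement_sup x.2 y.2⟩, (hsup x y).le.trans (sup_le hx hy), rfl⟩,
              le_sup_left, le_sup_right⟩) (isLUB_sSup _) (k.2.trans h)
      exact (hmono hkl).trans hl
  refine ⟨⟨F, fun s => (hgc.l_sSup (s := s)).trans sSup_image.symm⟩, fun k => ?_⟩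
  exact le_antisymm (iSup_le fun l => hmono l.2)
    (le_iSup (fun l : {l : {k : α // IsCompactElement k} // l.1 ≤ k.1} => g l.1) ⟨k, le_rfl⟩)

end CompactlyGenerated

namespace AlgFrmJ

/-- The compact elements of an algebraic frame. -/
abbrev Compacts (L : AlgFrmJ.{u}) : Type u := {k : L // IsCompactElement k}

/-- The lattice of compact elements of an arithmetic frame. -/
abbrev compactsDistribLattice (L : AlgFrmJ.{u}) (hL : IsArithmetic L) :
    DistribLattice L.Compacts :=
  { (Subtype.lattice (fun _ _ ha hb => isCompactElement_sup ha hb) (fun _ _ ha hb => hL _ _ ha hb) :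
      Lattice L.Compacts) with
    le_sup_inf := fun a b c => le_sup_inf (x := a.1) (y := b.1) (z := c.1) }

/-- The order dual of the lattice of compact elements of an arithmetic frame. -/
def compactsDual (L : AlgFrmJ.{u}) (hL : IsArithmetic L) : DMS.{u} :=
  letI := L.compactsDistribLattice hL
  letI : OrderBot L.Compacts := Subtype.orderBot isCompactElement_bot
  dmsOf L.Compactsᵒᵈ

theorem isLattice_compactsDual (L : AlgFrmJ.{u}) (hL : IsArithmetic L) :
    DMS.IsLattice (L.compactsDual hL) :=
  letI := L.compactsDistribLattice hL
  letI : OrderBot L.Compacts := Subtype.orderBot isCompactElement_bot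
  isLattice_dmsOf L.Compactsᵒᵈ

variable {L M : AlgFrmJ.{u}} (hL : IsArithmetic L) (hM : IsArithmetic M)

/-- The restriction of a morphism to compact elements. -/
def restrictCompacts (f : L ⟶ M) : L.compactsDual hL ⟶ M.compactsDual hM :=
  ObjectProperty.homMk
    (⟨⟨fun k => OrderDual.toDual (⟨f.map (OrderDual.ofDual k).1,
      f.map_compact _ (OrderDual.ofDual k).2⟩ : M.Compacts),
      fun a b => Subtype.ext (map_sup f.map (OrderDual.ofDual a).1 (OrderDual.ofDual b).1)⟩,
      Subtype.ext (map_bot f.map)⟩ :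
      InfTopHom (L.compactsDual hL).obj (M.compactsDual hM).obj)

theorem restrictCompacts_injective :
    Function.Injective (restrictCompacts hL hM : (L ⟶ M) → _) := by
  intro f g h
  refine Hom.ext (sSupHom_ext_compact fun k hk => ?_)
  have h' := congrArg (fun φ => DMS.map φ (OrderDual.toDual (⟨k, hk⟩ : L.Compacts))) h
  exact congrArg Subtype.val h'

/-- Meets in the dual are joins of compact elements, so `g` preserves finite joins and extends to
the whole frame. -/
theorem restrictCompacts_surjective :
    Function.Surjective (restrictCompacts hL hM : (L ⟶ M) → _) := by
  intro g
  let g' : L.Compacts → M.Compacts := fun k => OrderDual.ofDual (DMS.map g (OrderDual.toDual k))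
  obtain ⟨f, hf⟩ := exists_sSupHom_extension (fun k => (g' k).1)
    (congrArg Subtype.val (map_top (DMS.map g)))
    (fun a b => by
      have h : g' ⟨a.1 ⊔ b.1, isCompactElement_sup a.2 b.2⟩ =
          ⟨(g' a).1 ⊔ (g' b).1, isCompactElement_sup (g' a).2 (g' b).2⟩ :=
        (DMS.map g).map_inf' (OrderDual.toDual a) (OrderDual.toDual b)
      rw [h])
  refine ⟨⟨f, fun k hk => ?_⟩, DMS.hom_ext fun k => ?_⟩
  · rw [hf ⟨k, hk⟩]
    exact (g' ⟨k, hk⟩).2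
  · exact Subtype.ext (hf (OrderDual.ofDual k))

theorem isLUB_compactsDual_iff (a b c : L.Compacts) :
    IsLUB {(OrderDual.toDual a : (L.compactsDual hL).obj), OrderDual.toDual b}
      (OrderDual.toDual c) ↔ c.1 = a.1 ⊓ b.1 := by
  let _ := L.compactsDistribLattice hL
  have h : IsLUB {OrderDual.toDual a, OrderDual.toDual b} (OrderDual.toDual (a ⊓ b)) :=
    isLUB_pair (a := OrderDual.toDual a) (b := OrderDual.toDual b)
  constructor
  · intro h'
    exact congrArg Subtype.val (IsLUB.unique (α := L.Compactsᵒᵈ) h' h)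
  · intro h'
    obtain rfl : c = a ⊓ b := Subtype.ext h'
    exact h

theorem preservesJoins_restrictCompacts_iff (f : L ⟶ M) :
    DMS.PreservesJoins (restrictCompacts hL hM f) ↔
      ∀ a b : L, IsCompactElement a → IsCompactElement b → f.map (a ⊓ b) = f.map a ⊓ f.map b := by
  rw [DMS.preservesJoins_iff (L.isLattice_compactsDual hL)]
  constructor
  · intro h a b ha hb
    exact (isLUB_compactsDual_iff hM ⟨f.map a, f.map_compact a ha⟩ ⟨f.map b, f.map_compact b hb⟩
      ⟨f.map (a ⊓ b), f.map_compact _ (hL a b ha hb)⟩).1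
      (h _ _ _ ((isLUB_compactsDual_iff hL ⟨a, ha⟩ ⟨b, hb⟩ ⟨a ⊓ b, hL a b ha hb⟩).2 rfl))
  · intro h a b c hc
    refine (isLUB_compactsDual_iff hM _ _ _).2 ?_
    have hc' := (isLUB_compactsDual_iff hL (OrderDual.ofDual a) (OrderDual.ofDual b)
      (OrderDual.ofDual c)).1 hc
    refine Eq.trans ?_ (h _ _ (OrderDual.ofDual a).2 (OrderDual.ofDual b).2)
    exact congrArg f.map hc'

include hL in
theorem preservesCompactMeets_iff (f : L ⟶ M) :
    PreservesCompactMeets f ↔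
      ∀ a b : L, IsCompactElement a → IsCompactElement b →
        f.map (a ⊓ b) = f.map a ⊓ f.map b := by
  constructor
  · intro h a b ha hb
    have := h {a, b} (Set.toFinite _) (Set.insert_nonempty _ _)
      (by rintro x (rfl | rfl) <;> assumption) (by rw [sInf_pair]; exact hL a b ha hb)
    rwa [Set.image_pair, sInf_pair, sInf_pair] at this
  · intro h S hS hne hc hk
    -- Compactness of the partial meets is carried through the induction, because `h` applies only
    -- to compact elements; arithmeticity supplies it.
    suffices IsCompactElement (sInf S) ∧ f.map (sInf S) = sInf (f.map '' S) from this.2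
    clear hk
    induction S, hS using Set.Finite.induction_on with
    | empty => exact absurd hne Set.not_nonempty_empty
    | @insert x S _ _ ih =>
      have hx := hc x (Set.mem_insert _ _)
      rcases S.eq_empty_or_nonempty with rfl | hS'
      · simpa using hx
      · have hS := fun s hs => hc s (Set.mem_insert_of_mem _ hs)
        obtain ⟨h₁, h₂⟩ := ih hS' hS
        rw [Set.image_insert_eq, sInf_insert, sInf_insert, h _ _ hx h₁, h₂]
        exact ⟨hL _ _ hx h₁, rfl⟩

/-- A compact element below `f a ⊓ f b` is below `f k ⊓ f l` for some compact `k ≤ a`, `l ≤ b`, so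
binary meets need checking only on compact elements. In the reversed order, coinitiality says that
each compact element of `M` lies below the image of a compact element, which is equivalent to `f ⊤ =
⊤`. -/
theorem preservesFiniteMeets_iff (f : L ⟶ M) :
    PreservesFiniteMeets f ↔ DMS.LiftsUpperBounds (restrictCompacts hL hM f) := by
  rw [DMS.liftsUpperBounds_iff (L.isLattice_compactsDual hL),
    preservesJoins_restrictCompacts_iff]
  constructor
  · intro h
    refine ⟨fun a b _ _ => ?_, fun y => ?_⟩
    · simpa [Set.image_pair] using h {a, b} (Set.toFinite _)
    · have htop : f.map ⊤ = ⊤ := by simpa using h ∅ Set.finite_empty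
      obtain ⟨k, hk, -, hyk⟩ := exists_compact_le_map f.map (OrderDual.ofDual y).2
        (le_top.trans htop.ge)
      exact ⟨OrderDual.toDual (⟨k, hk⟩ : L.Compacts), hyk⟩
  · rintro ⟨h, hl⟩ S hS
    have hinf (a b : L) : f.map (a ⊓ b) = f.map a ⊓ f.map b := by
      refine le_antisymm (OrderHomClass.mono f.map |>.map_inf_le a b) ?_
      rw [le_iff_compact_le_imp]
      intro c hc hcab
      obtain ⟨k, hk, hka, hck⟩ := exists_compact_le_map f.map hc (hcab.trans inf_le_left)
      obtain ⟨l, hl, hlb, hcl⟩ := exists_compact_le_map f.map hc (hcab.trans inf_le_right)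
      refine (le_inf hck hcl).trans ?_
      rw [← h k l hk hl]
      exact OrderHomClass.mono f.map (inf_le_inf hka hlb)
    have htop : f.map ⊤ = ⊤ := by
      rw [eq_top_iff, le_iff_compact_le_imp]
      intro c hc _
      obtain ⟨x, hx⟩ := hl (OrderDual.toDual (⟨c, hc⟩ : M.Compacts))
      exact le_trans (show c ≤ f.map (OrderDual.ofDual x).1 from hx)
        (OrderHomClass.mono f.map le_top)
    induction S, hS using Set.Finite.induction_on with
    | empty => simpa using htop
    | insert _ _ ih => rw [Set.image_insert_eq, sInf_insert, sInf_insert, hinf, ih]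

end AlgFrmJ

/-! ### The frame of ideals of a distributive lattice -/

section Ideals

variable {P : Type*} [DistribLattice P] [OrderBot P]

/-- The relative pseudocomplement of ideals. -/
def idealHimp (I J : Order.Ideal P) : Order.Ideal P where
  carrier := {x | ∀ y ∈ I, x ⊓ y ∈ J}
  lower' _ _ hba ha y hy := J.lower (inf_le_inf_right y hba) (ha y hy)
  nonempty' := ⟨⊥, fun y _ => by simp⟩
  directed' a ha b hb := ⟨a ⊔ b, fun y hy => by
    rw [inf_sup_right]
    exact Order.Ideal.sup_mem (ha y hy) (hb y hy), le_sup_left, le_sup_right⟩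

theorem le_idealHimp_iff (I J K : Order.Ideal P) : I ≤ idealHimp J K ↔ I ⊓ J ≤ K :=
  ⟨fun h _ hx => K.lower (le_inf le_rfl le_rfl) (h hx.1 _ hx.2),
    fun h _ hx _ hy => h ⟨I.lower inf_le_left hx, J.lower inf_le_right hy⟩⟩

/-- The ideals of a distributive lattice form a frame. -/
abbrev idealFrame (P : Type*) [DistribLattice P] [OrderBot P] : Order.Frame (Order.Ideal P) :=
  { (inferInstance : CompleteLattice (Order.Ideal P)) with
    himp := idealHimp
    le_himp_iff := le_idealHimp_iff
    compl := fun I => idealHimp I ⊥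
    himp_bot := fun _ => rfl }

omit [OrderBot P]

theorem directedOn_principal (I : Order.Ideal P) :
    DirectedOn (· ≤ ·) (Order.Ideal.principal '' (I : Set P)) := by
  rintro _ ⟨x, hx, rfl⟩ _ ⟨y, hy, rfl⟩
  exact ⟨_, ⟨x ⊔ y, Order.Ideal.sup_mem hx hy, rfl⟩, by simp, by simp⟩

theorem isLUB_principal (I : Order.Ideal P) :
    IsLUB (Order.Ideal.principal '' (I : Set P)) I := by
  constructor
  · rintro _ ⟨x, hx, rfl⟩
    exact Order.Ideal.principal_le_iff.2 hx
  · exact fun J hJ x hx => Order.Ideal.principal_le_iff.1 (hJ ⟨x, hx, rfl⟩)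

theorem isCompactElement_principal (p : P) : IsCompactElement (Order.Ideal.principal p) := by
  intro S I hne hd hI hp
  -- A directed union of ideals is an ideal, so it bounds the join `I`; hence `p` already lies in
  -- one member.
  have hU : Order.IsIdeal (⋃₀ (SetLike.coe '' S) : Set P) :=
    Order.isIdeal_sUnion_of_directedOn (by rintro _ ⟨J, _, rfl⟩; exact J.isIdeal)
      (hd.mono_comp fun _ _ h => h) (hne.image _)
  have hIU : I ≤ hU.toIdeal := hI.2 fun J hJ x hx => ⟨J, ⟨J, hJ, rfl⟩, hx⟩
  obtain ⟨_, ⟨J, hJ, rfl⟩, hpJ⟩ := hIU (Order.Ideal.principal_le_iff.1 hp)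
  exact ⟨J, hJ, Order.Ideal.principal_le_iff.2 hpJ⟩

/-- Every ideal is the directed join of its principal subideals, so a compact one equals one of
these. -/
theorem isCompactElement_ideal_iff (I : Order.Ideal P) :
    IsCompactElement I ↔ ∃ p, Order.Ideal.principal p = I := by
  constructor
  · intro h
    obtain ⟨_, ⟨p, hp, rfl⟩, hIp⟩ := h _ I (I.nonempty.image _) (directedOn_principal I)
      (isLUB_principal I) le_rfl
    exact ⟨p, le_antisymm (Order.Ideal.principal_le_iff.2 hp) hIp⟩
  · rintro ⟨p, rfl⟩
    exact isCompactElement_principal p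

end Ideals

/-- The algebraic frame of ideals of a distributive lattice with bottom. -/
def idealAlgFrm (P : Type u) [DistribLattice P] [OrderBot P] : AlgFrmJ.{u} :=
  letI := idealFrame P
  { carrier := Order.Ideal P
    algebraic := ⟨fun I => ⟨_, by
      rintro _ ⟨p, _, rfl⟩
      exact isCompactElement_principal p, (isLUB_principal I).sSup_eq⟩⟩ }

theorem isArithmetic_idealAlgFrm (P : Type u) [DistribLattice P] [OrderBot P] :
    AlgFrmJ.IsArithmetic (idealAlgFrm P) := by
  intro (I : Order.Ideal P) (J : Order.Ideal P) hI hJ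
  obtain ⟨p, rfl⟩ := (isCompactElement_ideal_iff I).1 hI
  obtain ⟨q, rfl⟩ := (isCompactElement_ideal_iff J).1 hJ
  refine (isCompactElement_ideal_iff _).2 ⟨p ⊓ q, ?_⟩
  exact Order.Ideal.ext (Set.ext fun x => le_inf_iff)

/-- Every distributive lattice with top is dual to the lattice of compact elements of an
arithmetic frame. -/
theorem exists_compactsDual_orderIso (α : Type u) [DistribLattice α] [OrderTop α] :
    ∃ (L : AlgFrmJ.{u}) (hL : L.IsArithmetic), Nonempty ((L.compactsDual hL).obj ≃o α) := by
  -- The top of `α` is the bottom that ideals of `αᵒᵈ` require. The compact ideals are the principal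
  -- ones, a copy of `αᵒᵈ`, and dualizing again returns `α`.
  refine ⟨idealAlgFrm αᵒᵈ, isArithmetic_idealAlgFrm αᵒᵈ, ⟨?_⟩⟩
  let e : αᵒᵈ ↪o (idealAlgFrm αᵒᵈ).Compacts :=
    { toFun := fun p => ⟨Order.Ideal.principal p, isCompactElement_principal p⟩
      inj' := fun p q h => by
        have h' : Order.Ideal.principal p = Order.Ideal.principal q := congrArg Subtype.val h
        exact le_antisymm (Order.Ideal.principal_le_iff.1 h'.le)
          (Order.Ideal.principal_le_iff.1 h'.ge)
      map_rel_iff' := Order.Ideal.principal_le_iff }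
  have he : Function.Surjective e := fun k => by
    obtain ⟨p, hp⟩ := (isCompactElement_ideal_iff _).1 k.2
    exact ⟨p, Subtype.ext hp⟩
  exact (OrderIso.dual (RelIso.ofSurjective e he).symm).trans (OrderIso.dualDual α).symm

/-! ### Arithmetic frames and distributive lattices -/

namespace AlgFrmJ

/-- Morphisms of arithmetic frames restricted to compact elements. -/
def toDLM : ArFrmJ.{u} ⥤ DLM.{u} where
  obj L := ⟨L.obj.compactsDual L.property, L.obj.isLattice_compactsDual L.property⟩
  map f := ObjectProperty.homMk (restrictCompacts _ _ f.hom)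

/-- Morphisms of arithmetic frames that preserve compact meets, restricted to compact elements. -/
def toDL : ArFrmS.{u} ⥤ DL.{u} where
  obj L := ⟨⟨L.obj.obj.compactsDual L.property⟩, L.obj.obj.isLattice_compactsDual L.property⟩
  map {L M} f := ObjectProperty.homMk ⟨restrictCompacts L.property M.property f.hom.hom,
    (preservesJoins_restrictCompacts_iff _ _ _).2
      ((preservesCompactMeets_iff L.property _).1 f.hom.property)⟩

/-- Frame homomorphisms of arithmetic frames, restricted to compact elements. -/
def toDLP : ArFrm.{u} ⥤ DLP.{u} where
  obj L := ⟨⟨L.obj.obj.compactsDual L.property⟩, L.obj.obj.isLattice_compactsDual L.property⟩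
  map {L M} f := ObjectProperty.homMk ⟨restrictCompacts L.property M.property f.hom.hom,
    (preservesFiniteMeets_iff _ _ _).1 f.hom.property⟩

theorem exists_compactsDual_orderIso_dms (M : DMS.{u}) (hM : DMS.IsLattice M) :
    ∃ (L : AlgFrmJ.{u}) (hL : L.IsArithmetic), Nonempty ((L.compactsDual hL).obj ≃o M.obj) :=
  let _ := M.distribLattice hM
  exists_compactsDual_orderIso M.obj

theorem isEquivalence_toDLM : toDLM.{u}.IsEquivalence where
  faithful := ⟨fun h =>
    ObjectProperty.hom_ext _ (restrictCompacts_injective _ _ (congrArg (·.hom) h))⟩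
  full := ⟨fun g => by
    obtain ⟨f, hf⟩ := restrictCompacts_surjective _ _ g.hom
    exact ⟨ObjectProperty.homMk f, ObjectProperty.hom_ext _ hf⟩⟩
  essSurj := ⟨fun M => by
    obtain ⟨L, hL, ⟨e⟩⟩ := exists_compactsDual_orderIso_dms M.obj M.property
    exact ⟨⟨L, hL⟩, ⟨ObjectProperty.isoMk _ (DMS.isoOfOrderIso e)⟩⟩⟩

theorem isEquivalence_toDL : toDL.{u}.IsEquivalence where
  faithful := ⟨fun h => ObjectProperty.hom_ext _ (WideSubcategory.hom_ext _
    (restrictCompacts_injective _ _ (congrArg (·.hom.hom) h)))⟩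
  full := ⟨fun {L M} g => by
    obtain ⟨f, hf⟩ := restrictCompacts_surjective L.property M.property g.hom.hom
    refine ⟨ObjectProperty.homMk ⟨f, (preservesCompactMeets_iff L.property _).2
      ((preservesJoins_restrictCompacts_iff L.property M.property _).1 ?_)⟩,
      ObjectProperty.hom_ext _ (WideSubcategory.hom_ext _ hf)⟩
    rw [hf]
    exact g.hom.property⟩
  essSurj := ⟨fun M => by
    obtain ⟨L, hL, ⟨e⟩⟩ := exists_compactsDual_orderIso_dms M.obj.obj M.property
    exact ⟨⟨⟨L⟩, hL⟩, ⟨ObjectProperty.isoMk _ (WideSubcategory.isoMk (DMS.isoOfOrderIso e)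
      (DMS.preservesJoins_homOfOrderIso _) (DMS.preservesJoins_homOfOrderIso _))⟩⟩⟩

theorem isEquivalence_toDLP : toDLP.{u}.IsEquivalence where
  faithful := ⟨fun h => ObjectProperty.hom_ext _ (WideSubcategory.hom_ext _
    (restrictCompacts_injective _ _ (congrArg (·.hom.hom) h)))⟩
  full := ⟨fun {L M} g => by
    obtain ⟨f, hf⟩ := restrictCompacts_surjective L.property M.property g.hom.hom
    refine ⟨ObjectProperty.homMk ⟨f,
      (preservesFiniteMeets_iff L.property M.property _).2 ?_⟩,
      ObjectProperty.hom_ext _ (WideSubcategory.hom_ext _ hf)⟩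
    rw [hf]
    exact g.hom.property⟩
  essSurj := ⟨fun M => by
    obtain ⟨L, hL, ⟨e⟩⟩ := exists_compactsDual_orderIso_dms M.obj.obj M.property
    exact ⟨⟨⟨L⟩, hL⟩, ⟨ObjectProperty.isoMk _ (WideSubcategory.isoMk (DMS.isoOfOrderIso e)
      (DMS.liftsUpperBounds_homOfOrderIso _) (DMS.liftsUpperBounds_homOfOrderIso _))⟩⟩⟩

end AlgFrmJ

/-! ### Priestley spaces with a greatest element -/

/-- The form of compactness behind all the arguments on spaces: containment of a directed
intersection in an open set is attained by one member. -/
theorem exists_subset_of_sInter_subset {α : Type*} [TopologicalSpace α] [CompactSpace α]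
    {S : Set (Set α)} {U : Set α} (hne : S.Nonempty) (hd : DirectedOn (· ⊇ ·) S)
    (hS : ∀ V ∈ S, IsClosed V) (hU : IsOpen U) (h : ⋂₀ S ⊆ U) : ∃ V ∈ S, V ⊆ U := by
  have : Nonempty S := hne.to_subtype
  obtain ⟨V, hV⟩ := exists_subset_nhds_of_isCompact' (V := fun V : S => V.1)
    (directedOn_iff_directed.1 hd) (fun V => (hS V.1 V.2).isCompact) (fun V => hS V.1 V.2)
    (U := U) (fun x hx => hU.mem_nhds (h (by rwa [Set.sInter_eq_iInter])))
  exact ⟨V.1, V.2, hV⟩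

/-- If `U` misses the greatest element `m`, then `m` is a maximal point of the complement, which is
forbidden; if `U` contains `m`, no point of the complement is `m`. -/
theorem isAdmissible_compl_singleton_iff {α : Type u} [PartialOrder α] [TopologicalSpace α]
    {m : α} (hm : IsTop m) {U : Set α} :
    IsAdmissible {m}ᶜ U ↔ IsClopen U ∧ IsUpperSet U ∧ m ∈ U := by
  refine ⟨fun h => ⟨h.1, h.2.1, by_contra fun hmU => ?_⟩,
    fun h => ⟨h.1, h.2.1, fun x hx hxm => hx.prop (hxm ▸ h.2.2)⟩⟩
  exact h.2.2 m ⟨hmU, fun y _ _ => hm y⟩ rfl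

/-- A separating clopen upset contains `x`, hence also `m`, and so is automatically admissible. -/
theorem exists_isAdmissible_of_not_le {α : Type u} [PartialOrder α] [TopologicalSpace α]
    [PriestleySpace α] {m : α} (hm : IsTop m) {x y : α} (h : ¬ x ≤ y) :
    ∃ U, IsAdmissible {m}ᶜ U ∧ x ∈ U ∧ y ∉ U := by
  obtain ⟨U, hU, hU', hx, hy⟩ := exists_isClopen_upper_of_not_le h
  exact ⟨U, (isAdmissible_compl_singleton_iff hm).2 ⟨hU, hU', hU' (hm x) hx⟩, hx, hy⟩

/-- A compact Priestley space with a greatest element is a pointed Priestley space. -/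
def PGPS.ofIsTop (α : Type u) [PartialOrder α] [TopologicalSpace α] [CompactSpace α]
    [PriestleySpace α] (m : α) (hm : IsTop m) : PGPS.{u} where
  carrier := α
  X₀ := {m}ᶜ
  m := m
  isTop_m := hm
  subset_compl := subset_rfl
  dense := subset_closure
  order_dense x hx := ⟨x, hx, le_rfl⟩
  mem_X₀_iff x := by
    constructor
    · intro hx
      obtain ⟨U, hU, hmU, hxU⟩ := exists_isAdmissible_of_not_le hm
        (fun h => hx (le_antisymm (hm x) h) : ¬ m ≤ x)
      refine ⟨⟨U, hU, hxU⟩, fun V hV W hW => ⟨V ∪ W, ⟨?_, fun h => h.elim hV.2 hW.2⟩,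
        Set.subset_union_left, Set.subset_union_right⟩⟩
      have hV' := (isAdmissible_compl_singleton_iff hm).1 hV.1
      have hW' := (isAdmissible_compl_singleton_iff hm).1 hW.1
      exact (isAdmissible_compl_singleton_iff hm).2
        ⟨hV'.1.union hW'.1, hV'.2.1.union hW'.2.1, Or.inl hV'.2.2⟩
    · rintro ⟨⟨U, hU, hxU⟩, -⟩ rfl
      exact hxU ((isAdmissible_compl_singleton_iff hm).1 hU).2.2
  le_iff x y := by
    refine ⟨fun h U hU hx => hU.2.1 h hx, fun h => by_contra fun hxy => ?_⟩
    obtain ⟨U, hU, hx, hy⟩ := exists_isAdmissible_of_not_le hm hxy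
    exact hy (h U hU hx)

namespace PGPS

/-- The admissible clopen upsets of `X`, as a type. -/
abbrev Admissible (X : PGPS.{u}) : Type u := {U : Set X // U ∈ X.admissible}

variable {X Y : PGPS.{u}} (hX : X.IsPointedPriestley) (hY : Y.IsPointedPriestley)

include hX in
theorem mem_admissible_iff {U : Set X} :
    U ∈ X.admissible ↔ IsClopen U ∧ IsUpperSet U ∧ X.m ∈ U := by
  have h : X.X₀ = {X.m}ᶜ := hX
  rw [← isAdmissible_compl_singleton_iff X.isTop_m, ← h]
  rfl

include hX in
theorem union_mem_admissible {U V : Set X} (hU : U ∈ X.admissible) (hV : V ∈ X.admissible) :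
    U ∪ V ∈ X.admissible := by
  rw [mem_admissible_iff hX] at *
  exact ⟨hU.1.union hV.1, hU.2.1.union hV.2.1, Or.inl hU.2.2⟩

/-- The distributive lattice of admissible clopen upsets of a pointed Priestley space. -/
abbrev admissibleDistribLattice : DistribLattice X.Admissible :=
  { (Subtype.lattice (fun _ _ hU hV => union_mem_admissible hX hU hV)
      (fun _ _ hU hV => IsAdmissible.inter hU hV) : Lattice X.Admissible) with
    le_sup_inf := fun U V W => le_sup_inf (x := U.1) (y := V.1) (z := W.1) }

/-- The distributive meet-semilattice of admissible clopen upsets. -/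
def admissibleDMS : DMS.{u} :=
  letI := admissibleDistribLattice hX
  letI : OrderTop X.Admissible := Subtype.orderTop (IsAdmissible.univ _)
  dmsOf X.Admissible

theorem isLattice_admissibleDMS : DMS.IsLattice (admissibleDMS hX) :=
  letI := admissibleDistribLattice hX
  letI : OrderTop X.Admissible := Subtype.orderTop (IsAdmissible.univ _)
  isLattice_dmsOf X.Admissible

include hX in
theorem isLUB_admissibleDMS_iff (U V W : X.Admissible) :
    IsLUB {U, V} W ↔ W.1 = U.1 ∪ V.1 := by
  let _ := admissibleDistribLattice hX
  have h : IsLUB {U, V} (U ⊔ V) := isLUB_pair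
  constructor
  · intro h'
    exact congrArg Subtype.val (IsLUB.unique (α := X.Admissible) h' h)
  · intro h'
    obtain rfl : W = U ⊔ V := Subtype.ext h'
    exact h

/-! ### Relations and meet-preserving maps -/

/-- The map of admissible clopen upsets induced by a generalized Priestley morphism. -/
def boxHom (R : Hom X Y) : admissibleDMS hY ⟶ admissibleDMS hX :=
  ObjectProperty.homMk
    (⟨⟨fun U => (⟨box R.rel U.1, R.box_mem U.1 U.2⟩ : X.Admissible),
      fun _ _ => Subtype.ext (Set.ext fun _ =>
        ⟨fun h => ⟨fun y hy => (h y hy).1, fun y hy => (h y hy).2⟩,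
          fun h y hy => ⟨h.1 y hy, h.2 y hy⟩⟩)⟩,
      Subtype.ext (Set.eq_univ_of_forall fun _ y _ => Set.mem_univ y)⟩ :
      InfTopHom (admissibleDMS hY).obj (admissibleDMS hX).obj)

theorem boxHom_injective : Function.Injective (boxHom hX hY) := by
  intro R S h
  refine Hom.ext_box fun U hU => ?_
  have h' := congrArg (fun φ => DMS.map φ (⟨U, hU⟩ : Y.Admissible)) h
  exact congrArg Subtype.val h'

theorem boxHom_surjective : Function.Surjective (boxHom hX hY) := by
  intro h
  let g : Y.Admissible → X.Admissible := DMS.map h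
  have hmono : ∀ U V : Y.Admissible, U.1 ⊆ V.1 → (g U).1 ⊆ (g V).1 := fun U V hUV =>
    OrderHomClass.mono (DMS.map h) (show (U : (admissibleDMS hY).obj) ≤ V from hUV)
  have hinf : ∀ U V : Y.Admissible, (g ⟨U.1 ∩ V.1, IsAdmissible.inter U.2 V.2⟩).1 =
      (g U).1 ∩ (g V).1 := fun U V => congrArg Subtype.val ((DMS.map h).map_inf' U V)
  have htop : (g ⟨Set.univ, IsAdmissible.univ _⟩).1 = Set.univ :=
    congrArg Subtype.val (DMS.map h).map_top'
  -- The largest relation with `g U ⊆ box r U` for all admissible `U`.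
  let r : X → Y → Prop := fun x y => ∀ U : Y.Admissible, x ∈ (g U).1 → y ∈ U.1
  have hbox (U : Y.Admissible) : box r U.1 = (g U).1 := by
    -- The points related to `x` form the intersection of all `V` with `x ∈ g V`, a directed family
    -- as `g` preserves finite meets. If it lies in `U`, so does one such `V`, and monotonicity
    -- gives `x ∈ g U`.
    refine Set.Subset.antisymm (fun x hx => ?_) fun x hx y hy => hy U hx
    obtain ⟨_, ⟨V, hxV, rfl⟩, hVU⟩ := exists_subset_of_sInter_subset
      (S := Subtype.val '' {V : Y.Admissible | x ∈ (g V).1}) (U := U.1)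
      ⟨_, ⟨Set.univ, IsAdmissible.univ _⟩, htop.superset (Set.mem_univ x), rfl⟩
      (by
        rintro _ ⟨V, hV, rfl⟩ _ ⟨W, hW, rfl⟩
        exact ⟨_, ⟨⟨V.1 ∩ W.1, IsAdmissible.inter V.2 W.2⟩, (hinf V W).superset ⟨hV, hW⟩, rfl⟩,
          Set.inter_subset_left, Set.inter_subset_right⟩)
      (by rintro _ ⟨V, _, rfl⟩; exact V.2.1.1) U.2.1.2
      (fun y hy => hx y fun V hV => hy V.1 ⟨V, hV, rfl⟩)
    exact hmono V U hVU hxV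
  refine ⟨⟨r, fun x y hxy => ?_, fun U hU => hbox ⟨U, hU⟩ ▸ (g ⟨U, hU⟩).2⟩,
    DMS.hom_ext fun U => Subtype.ext (hbox U)⟩
  simp only [r, not_forall] at hxy
  obtain ⟨U, hxU, hyU⟩ := hxy
  exact ⟨U.1, U.2, fun z hz => hz U hxU, hyU⟩

end PGPS

namespace PGPSS

open PGPS

variable {X Y : PGPSS.{u}} (hX : X.space.IsPointedPriestley) (hY : Y.space.IsPointedPriestley)

/-! ### Strong Priestley morphisms and lattice homomorphisms -/

/-- Admissible sets determine the order, hence separate points. -/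
theorem hom_ext_preimage {f g : X ⟶ Y}
    (h : ∀ U ∈ Y.space.admissible, f.map ⁻¹' U = g.map ⁻¹' U) : f = g := by
  refine Hom.ext (funext fun x => le_antisymm ?_ ?_) <;> rw [Y.space.le_iff]
  · exact fun U hU hx => (h U hU).subset hx
  · exact fun U hU hx => (h U hU).superset hx

/-- The map of admissible clopen upsets induced by a strong Priestley morphism. -/
def preimageHom (f : X ⟶ Y) : admissibleDMS hY ⟶ admissibleDMS hX :=
  ObjectProperty.homMk
    (⟨⟨fun U => (⟨f.map ⁻¹' U.1, f.preimage_mem U.1 U.2⟩ : X.space.Admissible),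
      fun _ _ => rfl⟩, rfl⟩ :
      InfTopHom (admissibleDMS hY).obj (admissibleDMS hX).obj)

theorem preservesJoins_preimageHom (f : X ⟶ Y) : DMS.PreservesJoins (preimageHom hX hY f) := by
  rw [DMS.preservesJoins_iff (isLattice_admissibleDMS hY)]
  intro U V W hW
  refine (isLUB_admissibleDMS_iff hX _ _ _).2 ?_
  exact congrArg (f.map ⁻¹' ·) ((isLUB_admissibleDMS_iff hY U V W).1 hW)

theorem preimageHom_injective : Function.Injective (preimageHom hX hY) := by
  intro f g h
  refine hom_ext_preimage fun U hU => ?_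
  have h' := congrArg (fun φ => DMS.map φ (⟨U, hU⟩ : Y.space.Admissible)) h
  exact congrArg Subtype.val h'

end PGPSS

/-- Prime filters of admissible clopen upsets are given by points. -/
theorem PGPS.exists_mem_iff_of_prime {Y : PGPS.{u}} (hY : Y.IsPointedPriestley)
    (P : Set (Set Y)) (hP : P ⊆ Y.admissible) (hne : P.Nonempty)
    (hinter : ∀ U ∈ P, ∀ V ∈ P, U ∩ V ∈ P)
    (hmono : ∀ U ∈ P, ∀ V ∈ Y.admissible, U ⊆ V → V ∈ P)
    (hprime : ∀ U ∈ Y.admissible, ∀ V ∈ Y.admissible, U ∪ V ∈ P → U ∈ P ∨ V ∈ P) :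
    ∃ y : Y, ∀ U ∈ Y.admissible, y ∈ U ↔ U ∈ P := by
  by_cases hall : Y.admissible ⊆ P
  -- The improper filter is represented by `m`, which lies in every admissible set.
  · exact ⟨Y.m, fun U hU => iff_of_true ((mem_admissible_iff hY).1 hU).2.2 (hall hU)⟩
  · obtain ⟨V₀, hV₀, hV₀P⟩ := Set.not_subset.1 hall
    obtain ⟨U₀, hU₀⟩ := hne
    by_contra hcon
    push Not at hcon
    -- A point common to all differences `U \ V` with `U ∈ P` and `V ∉ P` would represent `P`; `U₀`
    -- and `V₀` fill the second slot when only one of the sets is given. Primeness makes the family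
    -- directed, so if there is no such point, some `U \ V` is empty, and `U ⊆ V` forces `V ∈ P`.
    obtain ⟨_, ⟨U, hU, V, hV, hVP, rfl⟩, hUV⟩ := exists_subset_of_sInter_subset
      (S := {W | ∃ U ∈ P, ∃ V ∈ Y.admissible, V ∉ P ∧ W = U \ V}) (U := ∅)
      ⟨_, U₀, hU₀, V₀, hV₀, hV₀P, rfl⟩
      (by
        rintro _ ⟨U, hU, V, hV, hVP, rfl⟩ _ ⟨U', hU', V', hV', hVP', rfl⟩
        exact ⟨_, ⟨U ∩ U', hinter U hU U' hU', V ∪ V', union_mem_admissible hY hV hV',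
          fun h => (hprime V hV V' hV' h).elim hVP hVP', rfl⟩,
          fun x hx => ⟨hx.1.1, fun h => hx.2 (Or.inl h)⟩,
          fun x hx => ⟨hx.1.2, fun h => hx.2 (Or.inr h)⟩⟩)
      (by
        rintro _ ⟨U, hU, V, hV, -, rfl⟩
        exact ((hP hU).1.diff hV.1).1) isOpen_empty
      (fun y hy => by
        obtain ⟨W, hW, h⟩ := hcon y
        rcases h with ⟨hyW, hWP⟩ | ⟨hyW, hWP⟩
        · exact (hy _ ⟨U₀, hU₀, W, hW, hWP, rfl⟩).2 hyW
        · exact hyW (hy _ ⟨W, hWP, V₀, hV₀, hV₀P, rfl⟩).1)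
    exact hVP (hmono U hU V hV (Set.sdiff_subset_iff.1 hUV |>.trans (by simp)))

namespace PGPSS

open PGPS

variable {X Y : PGPSS.{u}} (hX : X.space.IsPointedPriestley) (hY : Y.space.IsPointedPriestley)

theorem exists_preimageHom_eq (h : admissibleDMS hY ⟶ admissibleDMS hX)
    (hj : DMS.PreservesJoins h) : ∃ f : X ⟶ Y, preimageHom hX hY f = h := by
  let g : Y.space.Admissible → X.space.Admissible := DMS.map h
  have hmono : ∀ U V : Y.space.Admissible, U.1 ⊆ V.1 → (g U).1 ⊆ (g V).1 := fun U V hUV =>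
    OrderHomClass.mono (DMS.map h) (show (U : (admissibleDMS hY).obj) ≤ V from hUV)
  have hinf : ∀ U V : Y.space.Admissible, (g ⟨U.1 ∩ V.1, IsAdmissible.inter U.2 V.2⟩).1 =
      (g U).1 ∩ (g V).1 := fun U V => congrArg Subtype.val ((DMS.map h).map_inf' U V)
  have htop : (g ⟨Set.univ, IsAdmissible.univ _⟩).1 = Set.univ :=
    congrArg Subtype.val (DMS.map h).map_top'
  have hsup : ∀ U V : Y.space.Admissible, (g ⟨U.1 ∪ V.1, union_mem_admissible hY U.2 V.2⟩).1 =
      (g U).1 ∪ (g V).1 := fun U V =>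
    (isLUB_admissibleDMS_iff hX _ _ _).1
      ((DMS.preservesJoins_iff (isLattice_admissibleDMS hY) h).1 hj U V _
        ((isLUB_admissibleDMS_iff hY U V _).2 rfl))
  -- The sets `U` with `x ∈ g U` form a prime filter, possibly improper; its point is the value at
  -- `x`.
  have key (x : X.space) : ∃ y : Y.space, ∀ U ∈ Y.space.admissible,
      y ∈ U ↔ U ∈ Subtype.val '' {U : Y.space.Admissible | x ∈ (g U).1} := by
    refine exists_mem_iff_of_prime hY _ ?_
      ⟨_, ⟨Set.univ, IsAdmissible.univ _⟩, htop.superset (Set.mem_univ x), rfl⟩ ?_ ?_ ?_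
    · rintro _ ⟨U, _, rfl⟩
      exact U.2
    · rintro _ ⟨U, hU, rfl⟩ _ ⟨V, hV, rfl⟩
      exact ⟨_, (hinf U V).superset ⟨hU, hV⟩, rfl⟩
    · rintro _ ⟨U, hU, rfl⟩ V hV hUV
      exact ⟨⟨V, hV⟩, hmono U _ hUV hU, rfl⟩
    · rintro U hU V hV ⟨⟨_, _⟩, hW, rfl⟩
      rcases (hsup ⟨U, hU⟩ ⟨V, hV⟩).subset hW with h | h
      · exact Or.inl ⟨_, h, rfl⟩
      · exact Or.inr ⟨_, h, rfl⟩
  choose f hf using key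
  have hf' (U : Y.space.Admissible) : f ⁻¹' U.1 = (g U).1 := by
    ext x
    refine (hf x U.1 U.2).trans ⟨?_, fun h => ⟨U, h, rfl⟩⟩
    rintro ⟨V, hV, hVU⟩
    rwa [← Subtype.ext hVU]
  refine ⟨⟨f, fun x y hxy => ?_, fun U hU => hf' ⟨U, hU⟩ ▸ (g ⟨U, hU⟩).2⟩,
    DMS.hom_ext fun U => Subtype.ext (hf' U)⟩
  rw [Y.space.le_iff]
  intro U hU hx
  have hx' : x ∈ (g ⟨U, hU⟩).1 := (hf' ⟨U, hU⟩).subset hx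
  exact (hf' ⟨U, hU⟩).superset ((g ⟨U, hU⟩).2.2.1 hxy hx')

/-- The left side says that only `m` is sent to `m`. As `m` is the sole point in all admissible sets
of `Y`, its fibre is the directed intersection of the preimages `f⁻¹ U`. If the fibre lies in `{m}`,
compactness puts some `f⁻¹ U` inside any given admissible `V`. Conversely, a point `x ≠ m` is missed
by some admissible `V`, hence by some `f⁻¹ U`, while `m ∈ U`. -/
theorem preservesDensePart_iff (f : X ⟶ Y) :
    PreservesDensePart f ↔ DMS.LiftsUpperBounds (preimageHom hX hY f) := by
  rw [DMS.liftsUpperBounds_iff (isLattice_admissibleDMS hY)]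
  have hX' : X.space.X₀ = {X.space.m}ᶜ := hX
  have hY' : Y.space.X₀ = {Y.space.m}ᶜ := hY
  constructor
  · intro h
    refine ⟨preservesJoins_preimageHom hX hY f, fun (V : X.space.Admissible) => ?_⟩
    obtain ⟨_, ⟨U, hU, rfl⟩, hUV⟩ := exists_subset_of_sInter_subset
      (S := (f.map ⁻¹' ·) '' Y.space.admissible) (U := V.1)
      ⟨_, _, IsAdmissible.univ _, rfl⟩
      (by
        rintro _ ⟨U, hU, rfl⟩ _ ⟨W, hW, rfl⟩
        exact ⟨_, ⟨U ∩ W, IsAdmissible.inter hU hW, rfl⟩,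
          Set.preimage_mono Set.inter_subset_left, Set.preimage_mono Set.inter_subset_right⟩)
      (by rintro _ ⟨U, hU, rfl⟩; exact (f.preimage_mem U hU).1.1) V.2.1.2
      (fun x hx => by
        by_cases hxm : x = X.space.m
        · exact hxm ▸ ((mem_admissible_iff hX).1 V.2).2.2
        · have hfx : f.map x ≠ Y.space.m := (hY' ▸ h x (hX' ▸ hxm) : f.map x ∈ {Y.space.m}ᶜ)
          refine absurd (le_antisymm (Y.space.isTop_m _) ?_) hfx
          rw [Y.space.le_iff]
          exact fun U hU _ => hx _ ⟨U, hU, rfl⟩)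
    exact ⟨(⟨U, hU⟩ : Y.space.Admissible), hUV⟩
  · rintro ⟨-, hl⟩ x hx
    rw [hY']
    intro hfx
    have hxm : x ≠ X.space.m := (hX' ▸ hx : x ∈ {X.space.m}ᶜ)
    have hle : ¬ X.space.m ≤ x := fun h => hxm (le_antisymm (X.space.isTop_m x) h)
    rw [X.space.le_iff] at hle
    push Not at hle
    obtain ⟨V, hV, -, hxV⟩ := hle
    obtain ⟨U, hUV⟩ := hl (⟨V, hV⟩ : X.space.Admissible)
    refine hxV (hUV (show f.map x ∈ U.1 from ?_))
    rw [show f.map x = Y.space.m from hfx]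
    exact ((mem_admissible_iff hY).1 U.2).2.2

end PGPSS

/-! ### The prime filters of a distributive lattice with top -/

section PrimeFilters

variable (α : Type u) [DistribLattice α] [OrderTop α]

/-- The prime filters of a lattice, the improper one included, as characteristic functions. -/
def primeFilters : Set (α → Bool) :=
  {p | p ⊤ = true ∧ (∀ a b, p (a ⊓ b) = (p a && p b)) ∧ ∀ a b, p (a ⊔ b) = (p a || p b)}

theorem isClosed_primeFilters : IsClosed (primeFilters α) := by
  have h (f : Bool → Bool → Bool) (a b : α) : Continuous fun p : α → Bool => f (p a) (p b) :=
    Continuous.comp (g := fun x : Bool × Bool => f x.1 x.2)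
      (f := fun p : α → Bool => (p a, p b)) continuous_of_discreteTopology
      ((continuous_apply a).prodMk (continuous_apply b))
  have heq : primeFilters α = {p | p ⊤ = true} ∩
      ((⋂ (a) (b), {p | p (a ⊓ b) = (p a && p b)}) ∩
        ⋂ (a) (b), {p | p (a ⊔ b) = (p a || p b)}) := by
    ext p
    simp [primeFilters]
  rw [heq]
  exact (isClosed_eq (continuous_apply _) continuous_const).inter
    ((isClosed_iInter fun a => isClosed_iInter fun b =>
      isClosed_eq (continuous_apply _) (h and a b)).inter
    (isClosed_iInter fun a => isClosed_iInter fun b =>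
      isClosed_eq (continuous_apply _) (h or a b)))

instance : CompactSpace (primeFilters α) :=
  isCompact_iff_compactSpace.1 (isClosed_primeFilters α).isCompact

variable {α}

/-- The prime filters containing `a`. -/
def primeFiltersContaining (a : α) : Set (primeFilters α) := {p | p.1 a = true}

theorem isClopen_primeFiltersContaining (a : α) : IsClopen (primeFiltersContaining a) :=
  (isClopen_discrete {true}).preimage ((continuous_apply a).comp continuous_subtype_val)

theorem primeFilters_le_iff {p q : primeFilters α} :
    p ≤ q ↔ ∀ a, p.1 a = true → q.1 a = true :=
  forall_congr' fun _ => Bool.le_iff_imp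

theorem isUpperSet_primeFiltersContaining (a : α) : IsUpperSet (primeFiltersContaining a) :=
  fun _ _ h hp => primeFilters_le_iff.1 h a hp

instance : PriestleySpace (primeFilters α) where
  priestley {p q} h := by
    rw [primeFilters_le_iff] at h
    push Not at h
    obtain ⟨a, hp, hq⟩ := h
    exact ⟨_, isClopen_primeFiltersContaining a, isUpperSet_primeFiltersContaining a, hp, hq⟩

theorem primeFiltersContaining_inf (a b : α) : primeFiltersContaining (a ⊓ b) =
    primeFiltersContaining a ∩ primeFiltersContaining b :=
  Set.ext fun p => by simp [primeFiltersContaining, p.2.2.1 a b]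

theorem primeFiltersContaining_sup (a b : α) : primeFiltersContaining (a ⊔ b) =
    primeFiltersContaining a ∪ primeFiltersContaining b :=
  Set.ext fun p => by simp [primeFiltersContaining, p.2.2.2 a b]

theorem primeFiltersContaining_subset_iff {a b : α} :
    primeFiltersContaining a ⊆ primeFiltersContaining b ↔ a ≤ b := by
  classical
  constructor
  · intro h
    by_contra hab
    -- If `a ≰ b`, the prime ideal theorem gives a prime ideal containing `b` and missing `a`; its
    -- complement is a prime filter separating them.
    have hdisj : Disjoint (Order.PFilter.principal a : Set α) (Order.Ideal.principal b : Set α) :=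
      Set.disjoint_left.2 fun x hx hx' => hab (le_trans hx hx')
    obtain ⟨J, hJ, hbJ, haJ⟩ := DistribLattice.prime_ideal_of_disjoint_filter_ideal hdisj
    have ha : a ∉ J := Set.disjoint_left.1 haJ (Order.PFilter.mem_principal.2 le_rfl)
    have hp : (fun x => decide (x ∉ J)) ∈ primeFilters α := by
      refine ⟨decide_eq_true fun h => ha (J.lower le_top h), fun x y => ?_, fun x y => ?_⟩
      · have : x ⊓ y ∈ J ↔ x ∈ J ∨ y ∈ J :=
          ⟨hJ.mem_or_mem, fun h => h.elim (J.lower inf_le_left) (J.lower inf_le_right)⟩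
        simp [this]
      · by_cases hx : x ∈ J <;> simp [Order.Ideal.sup_mem_iff, hx]
    have hb := h (show (⟨_, hp⟩ : primeFilters α) ∈ primeFiltersContaining a from
      decide_eq_true ha)
    exact of_decide_eq_true hb (Order.Ideal.principal_le_iff.1 hbJ)
  · rintro h p hp
    rw [← inf_eq_left.2 h, primeFiltersContaining_inf] at hp
    exact hp.2

variable (α)

/-- The greatest prime filter is the improper one. -/
theorem const_true_mem_primeFilters : (fun _ => true) ∈ primeFilters α :=
  ⟨rfl, fun _ _ => rfl, fun _ _ => rfl⟩

theorem isTop_primeFilters :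
    IsTop (⟨fun _ => true, const_true_mem_primeFilters α⟩ : primeFilters α) :=
  fun _ => primeFilters_le_iff.2 fun _ _ => rfl

variable {α}

/-- The basic sets around `p` intersect in the upset generated by `p`, so compactness fits one of
them inside `U`. Basic sets are closed under union, so compactness of `U` leaves a single one.
Nonemptiness is essential: every basic set contains the improper filter. -/
theorem exists_primeFiltersContaining_eq {U : Set (primeFilters α)} (hU : IsClopen U)
    (hup : IsUpperSet U) (hne : U.Nonempty) : ∃ a, primeFiltersContaining a = U := by
  have hbasis : ∀ p ∈ U, ∃ a, p ∈ primeFiltersContaining a ∧ primeFiltersContaining a ⊆ U := by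
    intro p hp
    obtain ⟨_, ⟨a, ha, rfl⟩, haU⟩ := exists_subset_of_sInter_subset
      (S := primeFiltersContaining '' {a | p.1 a = true}) (U := U) ⟨_, ⊤, p.2.1, rfl⟩
      (by
        rintro _ ⟨a, ha, rfl⟩ _ ⟨b, hb, rfl⟩
        have ha : p.1 a = true := ha
        have hb : p.1 b = true := hb
        refine ⟨_, ⟨a ⊓ b, (p.2.2.1 a b).trans (by rw [ha, hb]; rfl), rfl⟩, ?_, ?_⟩ <;>
          rw [primeFiltersContaining_inf]
        exacts [Set.inter_subset_left, Set.inter_subset_right])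
      (by rintro _ ⟨a, _, rfl⟩; exact (isClopen_primeFiltersContaining a).1) hU.2
      (fun q hq => hup (primeFilters_le_iff.2 fun a ha => hq _ ⟨a, ha, rfl⟩) hp)
    exact ⟨a, ha, haU⟩
  have : Nonempty {a : α // primeFiltersContaining a ⊆ U} := by
    obtain ⟨p, hp⟩ := hne
    obtain ⟨a, -, ha⟩ := hbasis p hp
    exact ⟨⟨a, ha⟩⟩
  obtain ⟨a, ha⟩ := hU.1.isCompact.elim_directed_cover
    (fun a : {a : α // primeFiltersContaining a ⊆ U} => primeFiltersContaining a.1)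
    (fun a => (isClopen_primeFiltersContaining a.1).2)
    (fun p hp => by
      obtain ⟨a, hpa, ha⟩ := hbasis p hp
      exact Set.mem_iUnion.2 ⟨⟨a, ha⟩, hpa⟩)
    (fun a b => by
      have h := primeFiltersContaining_sup a.1 b.1
      exact ⟨⟨a.1 ⊔ b.1, h.subset.trans (Set.union_subset a.2 b.2)⟩,
        Set.subset_union_left.trans h.superset, Set.subset_union_right.trans h.superset⟩)
  exact ⟨a.1, Set.Subset.antisymm a.2 ha⟩

end PrimeFilters

namespace PGPS

/-- Every distributive lattice with top is the lattice of admissible clopen upsets of a pointed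
Priestley space. -/
theorem exists_admissibleDMS_orderIso (α : Type u) [DistribLattice α] [OrderTop α] :
    ∃ (X : PGPS.{u}) (hX : X.IsPointedPriestley), Nonempty ((admissibleDMS hX).obj ≃o α) := by
  let X : PGPS.{u} := PGPS.ofIsTop (primeFilters α) _ (isTop_primeFilters α)
  have hX : X.IsPointedPriestley := rfl
  refine ⟨X, hX, ⟨?_⟩⟩
  let e : α ↪o X.Admissible :=
    { toFun := fun a => ⟨primeFiltersContaining a, (mem_admissible_iff hX).2
        ⟨isClopen_primeFiltersContaining a, isUpperSet_primeFiltersContaining a, rfl⟩⟩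
      inj' := fun a b h => by
        have h' : primeFiltersContaining a = primeFiltersContaining b := congrArg Subtype.val h
        exact le_antisymm (primeFiltersContaining_subset_iff.1 h'.subset)
          (primeFiltersContaining_subset_iff.1 h'.superset)
      map_rel_iff' := primeFiltersContaining_subset_iff }
  have he : Function.Surjective e := fun U => by
    obtain ⟨h₁, h₂, h₃⟩ := (mem_admissible_iff hX).1 U.2
    obtain ⟨a, ha⟩ := exists_primeFiltersContaining_eq h₁ h₂ ⟨_, h₃⟩
    exact ⟨a, Subtype.ext ha⟩
  exact (RelIso.ofSurjective e he).symm

theorem exists_admissibleDMS_orderIso_dms (M : DMS.{u}) (hM : DMS.IsLattice M) :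
    ∃ (X : PGPS.{u}) (hX : X.IsPointedPriestley), Nonempty ((admissibleDMS hX).obj ≃o M.obj) :=
  let _ := M.distribLattice hM
  exists_admissibleDMS_orderIso M.obj

/-! ### Pointed Priestley spaces and distributive lattices -/

/-- The contravariant functor of admissible clopen upsets, on generalized Priestley morphisms. -/
def toDLM : PPS.{u}ᵒᵖ ⥤ DLM.{u} where
  obj X := ⟨admissibleDMS X.unop.property, isLattice_admissibleDMS X.unop.property⟩
  map f := ObjectProperty.homMk (boxHom _ _ f.unop.hom)
  map_id X := ObjectProperty.hom_ext _ (DMS.hom_ext fun U =>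
    Subtype.ext (box_id X.unop.obj U.2))
  map_comp f g := ObjectProperty.hom_ext _ (DMS.hom_ext fun U =>
    Subtype.ext (Hom.box_comp g.unop.hom f.unop.hom U.2))

theorem isEquivalence_toDLM : toDLM.{u}.IsEquivalence where
  faithful := ⟨fun h => Quiver.Hom.unop_inj
    (ObjectProperty.hom_ext _ (boxHom_injective _ _ (congrArg (·.hom) h)))⟩
  full := ⟨fun g => by
    obtain ⟨f, hf⟩ := boxHom_surjective _ _ g.hom
    exact ⟨Quiver.Hom.op (ObjectProperty.homMk f), ObjectProperty.hom_ext _ hf⟩⟩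
  essSurj := ⟨fun M => by
    obtain ⟨X, hX, ⟨e⟩⟩ := exists_admissibleDMS_orderIso_dms M.obj M.property
    exact ⟨.op ⟨X, hX⟩, ⟨ObjectProperty.isoMk _ (DMS.isoOfOrderIso e)⟩⟩⟩

end PGPS

namespace PGPSS

open PGPS

/-- The contravariant functor of admissible clopen upsets, on strong Priestley morphisms. -/
def toDL : PPSS.{u}ᵒᵖ ⥤ DL.{u} where
  obj X := ⟨⟨admissibleDMS X.unop.property⟩, isLattice_admissibleDMS X.unop.property⟩
  map {X Y} f := ObjectProperty.homMk ⟨preimageHom Y.unop.property X.unop.property f.unop.hom,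
    preservesJoins_preimageHom _ _ _⟩

/-- The contravariant functor of admissible clopen upsets, on strong Priestley morphisms that
preserve the dense part. -/
def toDLP : PPSP.{u}ᵒᵖ ⥤ DLP.{u} where
  obj X := ⟨⟨admissibleDMS X.unop.property⟩, isLattice_admissibleDMS X.unop.property⟩
  map {X Y} f := ObjectProperty.homMk
    ⟨preimageHom Y.unop.property X.unop.property f.unop.hom.hom,
      (preservesDensePart_iff _ _ _).1 f.unop.hom.property⟩

theorem isEquivalence_toDL : toDL.{u}.IsEquivalence where
  faithful := ⟨fun h => Quiver.Hom.unop_inj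
    (ObjectProperty.hom_ext _ (preimageHom_injective _ _ (congrArg (·.hom.hom) h)))⟩
  full := ⟨fun {X Y} g => by
    obtain ⟨f, hf⟩ := exists_preimageHom_eq Y.unop.property X.unop.property g.hom.hom
      g.hom.property
    exact ⟨Quiver.Hom.op (ObjectProperty.homMk f),
      ObjectProperty.hom_ext _ (WideSubcategory.hom_ext _ hf)⟩⟩
  essSurj := ⟨fun M => by
    obtain ⟨X, hX, ⟨e⟩⟩ := exists_admissibleDMS_orderIso_dms M.obj.obj M.property
    exact ⟨.op ⟨⟨X⟩, hX⟩, ⟨ObjectProperty.isoMk _ (WideSubcategory.isoMk (DMS.isoOfOrderIso e)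
      (DMS.preservesJoins_homOfOrderIso _) (DMS.preservesJoins_homOfOrderIso _))⟩⟩⟩

theorem isEquivalence_toDLP : toDLP.{u}.IsEquivalence where
  faithful := ⟨fun h => Quiver.Hom.unop_inj (ObjectProperty.hom_ext _ (WideSubcategory.hom_ext _
    (preimageHom_injective _ _ (congrArg (·.hom.hom) h))))⟩
  full := ⟨fun {X Y} g => by
    obtain ⟨f, hf⟩ := exists_preimageHom_eq Y.unop.property X.unop.property g.hom.hom
      ((DMS.liftsUpperBounds_iff (isLattice_admissibleDMS _) _).1 g.hom.property).1
    refine ⟨Quiver.Hom.op (ObjectProperty.homMk ⟨f,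
      (preservesDensePart_iff Y.unop.property X.unop.property f).2 ?_⟩),
      ObjectProperty.hom_ext _ (WideSubcategory.hom_ext _ hf)⟩
    rw [hf]
    exact g.hom.property⟩
  essSurj := ⟨fun M => by
    obtain ⟨X, hX, ⟨e⟩⟩ := exists_admissibleDMS_orderIso_dms M.obj.obj M.property
    exact ⟨.op ⟨⟨⟨X⟩⟩, hX⟩, ⟨ObjectProperty.isoMk _ (WideSubcategory.isoMk (DMS.isoOfOrderIso e)
      (DMS.liftsUpperBounds_homOfOrderIso _) (DMS.liftsUpperBounds_homOfOrderIso _))⟩⟩⟩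

end PGPSS

/-- Two categories equivalent to the same category, one of them contravariantly, are dually
equivalent. -/
noncomputable def dualEquivalence {C D E : Type*} [Category* C] [Category* D] [Category* E]
    (e : C ≌ D) (e' : Eᵒᵖ ≌ D) : Cᵒᵖ ≌ E :=
  (e.trans e'.symm).op.trans (opOpEquivalence E)

end PointedPriestley

theorem mainTheorem11 :
    (Nonempty (PointedPriestley.ArFrmJ.{u} ≌ PointedPriestley.DLM.{u}) ∧
      Nonempty (PointedPriestley.ArFrmJ.{u}ᵒᵖ ≌ PointedPriestley.PPS.{u})) ∧
    (Nonempty (PointedPriestley.ArFrmS.{u} ≌ PointedPriestley.DL.{u}) ∧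
      Nonempty (PointedPriestley.ArFrmS.{u}ᵒᵖ ≌ PointedPriestley.PPSS.{u})) ∧
    (Nonempty (PointedPriestley.ArFrm.{u} ≌ PointedPriestley.DLP.{u}) ∧
      Nonempty (PointedPriestley.ArFrm.{u}ᵒᵖ ≌ PointedPriestley.PPSP.{u})) := by
  have := PointedPriestley.AlgFrmJ.isEquivalence_toDLM.{u}
  have := PointedPriestley.AlgFrmJ.isEquivalence_toDL.{u}
  have := PointedPriestley.AlgFrmJ.isEquivalence_toDLP.{u}
  have := PointedPriestley.PGPS.isEquivalence_toDLM.{u}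
  have := PointedPriestley.PGPSS.isEquivalence_toDL.{u}
  have := PointedPriestley.PGPSS.isEquivalence_toDLP.{u}
  exact ⟨⟨⟨PointedPriestley.AlgFrmJ.toDLM.asEquivalence⟩,
      ⟨PointedPriestley.dualEquivalence PointedPriestley.AlgFrmJ.toDLM.asEquivalence
        PointedPriestley.PGPS.toDLM.asEquivalence⟩⟩,
    ⟨⟨PointedPriestley.AlgFrmJ.toDL.asEquivalence⟩,
      ⟨PointedPriestley.dualEquivalence PointedPriestley.AlgFrmJ.toDL.asEquivalence
        PointedPriestley.PGPSS.toDL.asEquivalence⟩⟩,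
    ⟨⟨PointedPriestley.AlgFrmJ.toDLP.asEquivalence⟩,
      ⟨PointedPriestley.dualEquivalence PointedPriestley.AlgFrmJ.toDLP.asEquivalence
        PointedPriestley.PGPSS.toDLP.asEquivalence⟩⟩⟩
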